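/- Let $\mathcal H$ be a complex Hilbert space and let $\mathcal L(\mathcal H)$ be the algebra of bounded linear operators on $\mathcal H$, with the operator norm; $\mathcal R(T)$ and $\mathcal N(T)$ denote the range and the nullspace of $T$, and $P_T$ denotes the orthogonal projection onto $\mathcal R(T)$ when $\mathcal R(T)$ is closed. A proper splitting of a closed range operator $T$ is a decomposition $T=U-V$ with $U,V\in\mathcal L(\mathcal H)$, $\mathcal R(U)=\mathcal R(T)$ and $\mathcal N(U)=\mathcal N(T)$. Given a closed subspace $\mathcal M$ with $\mathcal M\dotplus\mathcal N(T)=\mathcal H$ and $B\in\mathcal L(\mathcal H)$ with $\mathcal R(B)\subseteq\mathcal R(T)$, the reduced solution for $\mathcal M$ of $TX=B$ is the unique $X\in\mathcal L(\mathcal H)$ with $TX=B$ and $\mathcal R(X)\subseteq\mathcal M$. The iterative process of the proper splitting $T=U-V$ for $\mathcal M$ with respect to $B$ is $X^{i+1}=Y_{\mathcal M}X^i+Z_{\mathcal M}$, where $Y_{\mathcal M}$ and $Z_{\mathcal M}$ are the reduced solutions for $\mathcal M$ of $UY=V$ and $UZ=B$; it converges if, for every $X^0\in\mathcal L(\mathcal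 H)$, the sequence $(X^i)$ converges in operator norm. **Theorem.** Let $S\in\mathcal L(\mathcal H)$ be an operator with closed range such that $S=PA$ for some orthogonal projection $P$ and some Hermitian operator $A$ in $\mathcal L(\mathcal H)$, and suppose that $S$ is a split operator, that is, $\mathcal R(S)\dotplus\mathcal N(S)=\mathcal H$. Let $Q\in\mathcal L(\mathcal H)$ be the oblique projection onto $\mathcal R(S)$ along $\mathcal N(S)$, and put $U=P_SP_{S^*}$ and $W=U-S$. Then $S=U-W$ is a proper splitting of $S$. Moreover, this proper splitting converges if and only if $\|P_{S^*}-Q^*S\|<1$; more precisely, for every closed subspace $\mathcal M$ with $\mathcal M\dotplus\mathcal N(S)=\mathcal H$ and every $B\in\mathcal L(\mathcal H)$ with $\mathcal R(B)\subseteq\mathcal R(S)$, the iterative process of $S=U-W$ for $\mathcal M$ with respect to $B$ converges if and only if $\|P_{S^*}-Q^*S\|<1$, and when it converges, its limit, for every $X^0$, is the reduced solution for $\mathcal M$ of $SX=B$. -/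

import Mathlib

open Filter Topology

namespace ProperSplitting

variable {H : Type*} [NormedAddCommGroup H] [InnerProductSpace ℂ H] [CompleteSpace H]

/-- `P_T`: the orthogonal projection onto the closure of the range of `T`. For a closed range
operator this is the orthogonal projection onto `R(T)`, see `range_rangeProj`. -/
noncomputable def rangeProj (T : H →L[ℂ] H) : H →L[ℂ] H :=
  T.range.topologicalClosure.starProjection

theorem range_rangeProj {T : H →L[ℂ] H} (hT : IsClosed (T.range : Set H)) :
    (rangeProj T).range = T.range := by
  rw [rangeProj, Submodule.range_starProjection, hT.submodule_topologicalClosure_eq]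

/-- The class `𝒫 · 𝓛ʰ`: products of an orthogonal projection and a Hermitian operator. -/
def IsProjMulHermitian (S : H →L[ℂ] H) : Prop :=
  ∃ P A : H →L[ℂ] H, IsStarProjection P ∧ IsSelfAdjoint A ∧ S = P ∘L A

/-- `T` is a split operator: `H` is the (algebraic) direct sum of `R(T)` and `N(T)`. -/
def IsSplit (T : H →L[ℂ] H) : Prop := IsCompl T.range T.ker

theorem IsSplit.isTopCompl {T : H →L[ℂ] H} (h : IsSplit T)
    (hT : IsClosed (T.range : Set H)) : T.range.IsTopCompl T.ker :=
  Submodule.IsCompl.isTopCompl_of_isClosed h hT T.isClosed_ker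

/-- `Q_{R(T)//N(T)}`: the bounded oblique projection onto `R(T)` along `N(T)`. -/
noncomputable def obliqueProj (T : H →L[ℂ] H) (h : IsSplit T)
    (hT : IsClosed (T.range : Set H)) : H →L[ℂ] H :=
  T.range.projectionL T.ker (h.isTopCompl hT)

/-- `T = U - V` is a proper splitting of the closed range operator `T`. -/
structure IsProperSplitting (T U V : H →L[ℂ] H) : Prop where
  closed_range : IsClosed (T.range : Set H)
  eq_sub : T = U - V
  range_eq : U.range = T.range
  ker_eq : U.ker = T.ker

/-- `X` is a reduced solution for `M` of the equation `T X = B`. -/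
def IsReducedSolution (M : Submodule ℂ H) (T B X : H →L[ℂ] H) : Prop :=
  T ∘L X = B ∧ X.range ≤ M

/-- If `M` is a closed complement of `N(T)` and `R(B) ⊆ R(T)`, then `T X = B` has exactly one
reduced solution for `M`. -/
theorem existsUnique_isReducedSolution {M : Submodule ℂ H} {T B : H →L[ℂ] H}
    (hM : IsClosed (M : Set H)) (hMT : IsCompl M T.ker) (hB : B.range ≤ T.range) :
    ∃! X, IsReducedSolution M T B X := by
  have inj : ∀ x y, x ∈ M → y ∈ M → T x = T y → x = y := by
    intro x y hx hy hxy
    have h1 : x - y ∈ T.ker := by simp [LinearMap.mem_ker, hxy]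
    have h2 := Submodule.disjoint_def.1 hMT.disjoint _ (M.sub_mem hx hy) h1
    exact sub_eq_zero.1 h2
  have ex : ∀ x, ∃ y ∈ M, T y = B x := by
    intro x
    obtain ⟨z, hz⟩ := hB (LinearMap.mem_range_self (B : H →ₗ[ℂ] H) x)
    have hz' : z ∈ M ⊔ T.ker := by rw [hMT.sup_eq_top]; trivial
    obtain ⟨m, hm, n, hn, rfl⟩ := Submodule.mem_sup.1 hz'
    refine ⟨m, hm, ?_⟩
    have hn' : T n = 0 := hn
    simpa [hn'] using hz
  choose f hfM hf using ex
  let F : H →ₗ[ℂ] H :=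
    { toFun := f
      map_add' := fun x y => inj _ _ (hfM _) (M.add_mem (hfM _) (hfM _)) (by simp [hf])
      map_smul' := fun c x => inj _ _ (hfM _) (M.smul_mem _ (hfM _)) (by simp [hf]) }
  let X : H →L[ℂ] H := ContinuousLinearMap.ofSeqClosedGraph (g := F) (by
    intro u x y hu hy
    have hyM : y ∈ M := hM.mem_of_tendsto hy (Eventually.of_forall fun n => hfM (u n))
    refine inj _ _ hyM (hfM x) ((?_ : T y = B x).trans (hf x).symm)
    refine tendsto_nhds_unique ((T.continuous.tendsto y).comp hy) ?_
    have h3 : (T ∘ F ∘ u) = fun n => B (u n) := by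
      funext n
      exact hf (u n)
    rw [h3]
    exact (B.continuous.tendsto x).comp hu)
  refine ⟨X, ⟨ContinuousLinearMap.ext hf, ?_⟩, ?_⟩
  · rintro _ ⟨x, rfl⟩
    exact hfM x
  · rintro X' ⟨h1, h2⟩
    refine ContinuousLinearMap.ext fun x => inj _ _ (h2 ⟨x, rfl⟩) (hfM x) ?_
    exact (congrArg (fun Z : H →L[ℂ] H => Z x) h1).trans (hf x).symm

open Classical in
/-- The reduced solution `X_M` for `M` of the equation `T X = B`
(and `0` if there is none, which does not happen under the hypotheses of
`existsUnique_isReducedSolution`). -/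
noncomputable def reducedSolution (M : Submodule ℂ H) (T B : H →L[ℂ] H) : H →L[ℂ] H :=
  if h : ∃ X, IsReducedSolution M T B X then h.choose else 0

theorem reducedSolution_spec {M : Submodule ℂ H} {T B : H →L[ℂ] H}
    (hM : IsClosed (M : Set H)) (hMT : IsCompl M T.ker) (hB : B.range ≤ T.range) :
    IsReducedSolution M T B (reducedSolution M T B) := by
  have h := (existsUnique_isReducedSolution hM hMT hB).exists
  rw [reducedSolution, dif_pos h]
  exact h.choose_spec

/-- The iterative process for `M` of the splitting `T = U - V` with respect to `B`,
`X (i + 1) = Y_M (X i) + Z_M`, started at `X₀`, where `Y_M` and `Z_M` are the reduced solutions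
for `M` of `U Y = V` and `U Z = B`. -/
noncomputable def iterate (U V : H →L[ℂ] H) (M : Submodule ℂ H) (B X₀ : H →L[ℂ] H) :
    ℕ → (H →L[ℂ] H)
  | 0 => X₀
  | i + 1 => reducedSolution M U V ∘L iterate U V M B X₀ i + reducedSolution M U B

/-- The iterative process converges, in operator norm, whatever the starting operator is. -/
def ProcessConverges (U V : H →L[ℂ] H) (M : Submodule ℂ H) (B : H →L[ℂ] H) : Prop :=
  ∀ X₀ : H →L[ℂ] H, ∃ X : H →L[ℂ] H, Tendsto (iterate U V M B X₀) atTop (𝓝 X)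

end ProperSplitting

/-!
Write `P_S` and `P_{S*}` for the orthogonal projections onto `R(S)` and onto the closure of
`R(S*)`, that is, `N(S)ᗮ`.  Since `Q` is the oblique projection onto `R(S)` along `N(S)`,
comparing ranges and kernels gives
`Q P_S = P_S`, `P_S Q = Q`, `Q P_{S*} = Q` and `P_{S*} Q = P_{S*}`.
Taking adjoints, `U = P_S P_{S*}` satisfies `U Q* = P_S` and `Q* U = P_{S*}`: the operator `Q*` is
the Moore-Penrose inverse of `U`.  In particular `U` has the range and the kernel of `S`, which is
the proper splitting.

Let `Y` be the reduced solution for `M` of `U Y = W`, where `W = U - S`.  The reduced solution of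
`S X = B` is a fixed point of the iteration, so the error after `i` steps is `Y ^ i` times the
initial error (`iterate_sub_reducedSolution`).  If the process converges for every start, so do the
powers `Y ^ i`, and their limit `L` satisfies `Y L = L`, that is, `S L = 0` with the range of `L`
in `M`; this forces `L = 0`.  Hence the process converges if and only if `Y ^ i → 0`
(`processConverges_iff_tendsto_pow`), a condition in which `B` does not appear.

The dependence on `M` disappears on multiplying by `Q*`:
`P_{S*} Y = Q* U Y = Q* W = P_{S*} - Q* S`, and `Y P_{S*} = Y` because `Y` vanishes on `N(S)`.  So
`Y ^ i → 0` if and only if the powers of `P_{S*} - Q* S` tend to zero.  Finally, if `S = P A` with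
`P` an orthogonal projection and `A` Hermitian, then `P Q = Q` and `S Q = S` give `Q* S = Q* A Q`
(`isSelfAdjoint_adjoint_comp`), so `P_{S*} - Q* S` is selfadjoint and its powers tend to zero
exactly when its norm is less than one (`IsSelfAdjoint.tendsto_pow_zero_iff`).
-/

/-! ### Powers tending to zero -/

/-- For a selfadjoint element the norm is the spectral radius, so the powers tend to zero only if
the norm is less than one. -/
theorem IsSelfAdjoint.tendsto_pow_zero_iff {E : Type*} [NormedRing E] [StarRing E] [CStarRing E]
    {a : E} (ha : IsSelfAdjoint a) : Tendsto (fun n : ℕ => a ^ n) atTop (𝓝 0) ↔ ‖a‖ < 1 := by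
  refine ⟨fun h => ?_, tendsto_pow_atTop_nhds_zero_of_norm_lt_one⟩
  have h2 : Tendsto (fun n : ℕ => ‖a ^ 2 ^ n‖) atTop (𝓝 0) := by
    simpa using (h.comp (tendsto_pow_atTop_atTop_of_one_lt (one_lt_two : 1 < 2))).norm
  by_contra! hlt
  obtain ⟨n, hn⟩ := (h2.eventually_lt_const one_pos).exists
  have hpow : ‖a ^ 2 ^ n‖ = ‖a‖ ^ 2 ^ n := by
    simpa using congrArg NNReal.toReal (ha.nnnorm_pow_two_pow n)
  exact absurd (one_le_pow₀ hlt) (by rw [← hpow]; exact hn.not_ge)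

/-- If `y * p = y`, then `(p * y) ^ (n + 1) = p * y ^ (n + 1)` and `y ^ (n + 1) = y * (p * y) ^ n`,
so both sequences of powers tend to zero together. -/
theorem tendsto_pow_zero_iff_mul_left {R : Type*} [Ring R] [TopologicalSpace R]
    [IsTopologicalRing R] {p y : R} (h : y * p = y) :
    Tendsto (fun n : ℕ => y ^ n) atTop (𝓝 0) ↔
      Tendsto (fun n : ℕ => (p * y) ^ n) atTop (𝓝 0) := by
  have h1 (n : ℕ) : y * (p * y) ^ n = y ^ (n + 1) := by
    induction n with
    | zero => simp
    | succ n ih => rw [pow_succ, ← mul_assoc, ih, pow_succ, mul_assoc, ← mul_assoc y p, h,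
        ← mul_assoc, ← pow_succ, ← pow_succ]
  have h2 (n : ℕ) : (p * y) ^ (n + 1) = p * y ^ (n + 1) := by
    rw [pow_succ', mul_assoc, h1]
  rw [← tendsto_add_atTop_iff_nat 1, ← tendsto_add_atTop_iff_nat (f := fun n => (p * y) ^ n) 1]
  refine ⟨fun H => ?_, fun H => ?_⟩
  · simpa [h2] using H.const_mul p
  · simpa [h1] using ((tendsto_add_atTop_iff_nat 1).1 H).const_mul y

namespace ProperSplitting

variable {H : Type*} [NormedAddCommGroup H] [InnerProductSpace ℂ H] [CompleteSpace H]

/-! ### Orthogonal projections onto the ranges of an operator and its adjoint -/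

theorem isSelfAdjoint_rangeProj (T : H →L[ℂ] H) : IsSelfAdjoint (rangeProj T) :=
  isSelfAdjoint_starProjection _

theorem rangeProj_apply_of_mem {T : H →L[ℂ] H} {x : H} (hx : x ∈ T.range) :
    rangeProj T x = x :=
  Submodule.starProjection_eq_self_iff.2 (T.range.le_topologicalClosure hx)

theorem rangeProj_mem {T : H →L[ℂ] H} (hT : IsClosed (T.range : Set H)) (x : H) :
    rangeProj T x ∈ T.range := by
  rw [← range_rangeProj hT]
  exact ⟨x, rfl⟩

theorem ker_rangeProj_adjoint (T : H →L[ℂ] H) : (rangeProj T.adjoint).ker = T.ker := by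
  rw [rangeProj, Submodule.ker_starProjection, Submodule.orthogonal_closure,
    ContinuousLinearMap.orthogonal_range, ContinuousLinearMap.adjoint_adjoint]

theorem rangeProj_adjoint_apply_of_mem_ker {T : H →L[ℂ] H} {x : H} (hx : x ∈ T.ker) :
    rangeProj T.adjoint x = 0 := by
  rw [← ker_rangeProj_adjoint] at hx
  exact hx

theorem sub_rangeProj_adjoint_mem_ker (T : H →L[ℂ] H) (x : H) :
    x - rangeProj T.adjoint x ∈ T.ker := by
  rw [← ker_rangeProj_adjoint, rangeProj, Submodule.ker_starProjection]
  exact Submodule.sub_starProjection_mem_orthogonal x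

/-! ### The oblique projection and the pseudoinverse of `P_S P_{S*}` -/

section ObliqueProj

variable {S : H →L[ℂ] H} (hsplit : IsSplit S) (hS : IsClosed (S.range : Set H))

theorem obliqueProj_mem (x : H) : obliqueProj S hsplit hS x ∈ S.range := by
  simp [obliqueProj]

theorem obliqueProj_apply_of_mem {x : H} (hx : x ∈ S.range) : obliqueProj S hsplit hS x = x := by
  simpa [obliqueProj] using hx

theorem obliqueProj_apply_of_mem_ker {x : H} (hx : x ∈ S.ker) :
    obliqueProj S hsplit hS x = 0 := by
  simpa [obliqueProj] using hx

theorem sub_obliqueProj_mem_ker (x : H) : x - obliqueProj S hsplit hS x ∈ S.ker := by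
  rw [← S.range.projectionL_apply_eq_zero_iff (hsplit.isTopCompl hS)]
  change obliqueProj S hsplit hS _ = 0
  rw [map_sub, obliqueProj_apply_of_mem hsplit hS (obliqueProj_mem hsplit hS x), sub_self]

/-- `Q*` is a right inverse of `U = P_S P_{S*}` up to the projection onto `R(S)`. -/
theorem rangeProj_mul_rangeProj_mul_adjoint_obliqueProj :
    rangeProj S * rangeProj S.adjoint * (obliqueProj S hsplit hS).adjoint = rangeProj S := by
  have h1 : obliqueProj S hsplit hS * rangeProj S.adjoint = obliqueProj S hsplit hS := by
    ext x
    have := obliqueProj_apply_of_mem_ker hsplit hS (sub_rangeProj_adjoint_mem_ker S x)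
    rw [map_sub, sub_eq_zero] at this
    exact this.symm
  have h2 : obliqueProj S hsplit hS * rangeProj S = rangeProj S := by
    ext x
    exact obliqueProj_apply_of_mem hsplit hS (rangeProj_mem hS x)
  have h := congrArg star (show obliqueProj S hsplit hS * rangeProj S.adjoint * rangeProj S =
    rangeProj S by rw [h1, h2])
  simpa only [star_mul, (isSelfAdjoint_rangeProj _).star_eq, ← mul_assoc,
    ContinuousLinearMap.star_eq_adjoint] using h

/-- `Q*` is a left inverse of `U = P_S P_{S*}` up to the projection onto `N(S)ᗮ`. -/
theorem adjoint_obliqueProj_mul_rangeProj_mul_rangeProj :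
    (obliqueProj S hsplit hS).adjoint * (rangeProj S * rangeProj S.adjoint) =
      rangeProj S.adjoint := by
  have h1 : rangeProj S * obliqueProj S hsplit hS = obliqueProj S hsplit hS := by
    ext x
    exact rangeProj_apply_of_mem (obliqueProj_mem hsplit hS x)
  have h2 : rangeProj S.adjoint * obliqueProj S hsplit hS = rangeProj S.adjoint := by
    ext x
    have := rangeProj_adjoint_apply_of_mem_ker (sub_obliqueProj_mem_ker hsplit hS x)
    rw [map_sub, sub_eq_zero] at this
    exact this.symm
  have h := congrArg star (show rangeProj S.adjoint * (rangeProj S * obliqueProj S hsplit hS) =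
    rangeProj S.adjoint by rw [h1, h2])
  simpa only [star_mul, (isSelfAdjoint_rangeProj _).star_eq, mul_assoc,
    ContinuousLinearMap.star_eq_adjoint] using h

/-- The splitting with `U = P_S P_{S*}` is proper, because `U` has the pseudoinverse `Q*`. -/
theorem isProperSplitting_rangeProj_comp {S : H →L[ℂ] H} (hsplit : IsSplit S)
    (hS : IsClosed (S.range : Set H)) :
    IsProperSplitting S (rangeProj S ∘L rangeProj S.adjoint)
      (rangeProj S ∘L rangeProj S.adjoint - S) where
  closed_range := hS
  eq_sub := by simp
  range_eq := by
    apply le_antisymm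
    · rintro _ ⟨x, rfl⟩
      exact rangeProj_mem hS _
    · intro x hx
      refine ⟨(obliqueProj S hsplit hS).adjoint x, ?_⟩
      exact (congrArg (fun Z : H →L[ℂ] H => Z x)
        (rangeProj_mul_rangeProj_mul_adjoint_obliqueProj hsplit hS)).trans
          (rangeProj_apply_of_mem hx)
  ker_eq := by
    apply le_antisymm
    · intro x hx
      have hx' : rangeProj S (rangeProj S.adjoint x) = 0 := hx
      have h := congrArg (fun Z : H →L[ℂ] H => Z x)
        (adjoint_obliqueProj_mul_rangeProj_mul_rangeProj hsplit hS)
      rw [← ker_rangeProj_adjoint]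
      refine h.symm.trans ?_
      simp [hx']
    · intro x hx
      change rangeProj S (rangeProj S.adjoint x) = 0
      rw [rangeProj_adjoint_apply_of_mem_ker hx, map_zero]

/-- If `S = P A`, then `Q* S = Q* P A Q = Q* A Q`, since `S Q = S` and `P Q = Q`. -/
theorem isSelfAdjoint_adjoint_comp (hPL : IsProjMulHermitian S) :
    IsSelfAdjoint ((obliqueProj S hsplit hS).adjoint ∘L S) := by
  obtain ⟨P, A, hP, hA, hPA⟩ := hPL
  set Q := obliqueProj S hsplit hS with hQ
  have hPQ : P * Q = Q := by
    ext x
    obtain ⟨y, hy⟩ := obliqueProj_mem hsplit hS x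
    have hy' : S y = Q x := hy
    have hPP := congrArg (fun Z : H →L[ℂ] H => Z (A y)) hP.isIdempotentElem.eq
    change P (Q x) = Q x
    rw [← hy', hPA]
    exact hPP
  have hSQ : S * Q = S := by
    ext x
    have h : S (x - Q x) = 0 := sub_obliqueProj_mem_ker hsplit hS x
    rw [map_sub, sub_eq_zero] at h
    exact h.symm
  have hQP : star Q * P = star Q := by
    have h := congrArg star hPQ
    rwa [star_mul, hP.isSelfAdjoint.star_eq] at h
  have key : star Q * S = star Q * A * Q := by
    conv_lhs => rw [← hSQ, hPA]
    change star Q * (P * A * Q) = _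
    rw [← mul_assoc, ← mul_assoc, hQP]
  change IsSelfAdjoint (star Q * S)
  rw [key]
  exact hA.conjugate' Q

end ObliqueProj

/-! ### The error of the iterative process -/

section Iteration

variable {S U V : H →L[ℂ] H} {M : Submodule ℂ H}

theorem IsProperSplitting.isReducedSolution (h : IsProperSplitting S U V)
    (hM : IsClosed (M : Set H)) (hMS : IsCompl M S.ker) :
    IsReducedSolution M U V (reducedSolution M U V) := by
  refine reducedSolution_spec hM (h.ker_eq ▸ hMS) ?_
  have hVU : V = U - S := by rw [h.eq_sub]; abel
  rintro _ ⟨x, rfl⟩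
  rw [hVU]
  exact U.range.sub_mem ⟨x, rfl⟩ (h.range_eq ▸ ⟨x, rfl⟩)

/-- The reduced solution of `S X = B` is a fixed point of the iteration, which therefore multiplies
the error by the reduced solution of `U Y = V` at each step. -/
theorem iterate_sub_reducedSolution (h : IsProperSplitting S U V) (hM : IsClosed (M : Set H))
    (hMS : IsCompl M S.ker) {B : H →L[ℂ] H} (hB : B.range ≤ S.range) (X₀ : H →L[ℂ] H) (i : ℕ) :
    iterate U V M B X₀ i - reducedSolution M S B =
      reducedSolution M U V ^ i * (X₀ - reducedSolution M S B) := by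
  have hMU : IsCompl M U.ker := h.ker_eq ▸ hMS
  have hY := h.isReducedSolution hM hMS
  have hZ := reducedSolution_spec hM hMU (h.range_eq ▸ hB : B.range ≤ U.range)
  have hX := reducedSolution_spec hM hMS hB
  set Y := reducedSolution M U V
  set Z := reducedSolution M U B
  set X := reducedSolution M S B
  have hfix : Y * X + Z = X := by
    ext x
    have hmem : Y (X x) + Z x - X x ∈ M :=
      M.sub_mem (M.add_mem (hY.2 ⟨_, rfl⟩) (hZ.2 ⟨_, rfl⟩)) (hX.2 ⟨_, rfl⟩)
    have e1 : U (Y (X x)) = V (X x) := congrArg (fun T : H →L[ℂ] H => T (X x)) hY.1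
    have e2 : U (Z x) = B x := congrArg (fun T : H →L[ℂ] H => T x) hZ.1
    have e3 : S (X x) = B x := congrArg (fun T : H →L[ℂ] H => T x) hX.1
    have e4 : S (X x) = U (X x) - V (X x) := congrArg (fun T : H →L[ℂ] H => T (X x)) h.eq_sub
    have hker : Y (X x) + Z x - X x ∈ U.ker := by
      change U (Y (X x) + Z x - X x) = 0
      rw [map_sub, map_add, e1, e2, ← e3, e4]
      abel
    exact sub_eq_zero.1 (Submodule.disjoint_def.1 hMU.disjoint _ hmem hker)
  induction i with
  | zero => simp [iterate]
  | succ i ih =>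
    calc iterate U V M B X₀ (i + 1) - X = (Y * iterate U V M B X₀ i + Z) - (Y * X + Z) := by
          rw [hfix]; rfl
      _ = Y * (iterate U V M B X₀ i - X) := by rw [mul_sub]; abel
      _ = _ := by rw [ih, pow_succ', mul_assoc]

/-- A fixed point of `X ↦ Y X` has range in `M` and solves `U X = V X`, hence `S X = 0`. -/
theorem IsProperSplitting.eq_zero_of_reducedSolution_mul_eq (h : IsProperSplitting S U V)
    (hM : IsClosed (M : Set H)) (hMS : IsCompl M S.ker) {L : H →L[ℂ] H}
    (hL : reducedSolution M U V * L = L) : L = 0 := by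
  have hY := h.isReducedSolution hM hMS
  ext x
  have hLx : reducedSolution M U V (L x) = L x := congrArg (fun T : H →L[ℂ] H => T x) hL
  have e1 : U (reducedSolution M U V (L x)) = V (L x) :=
    congrArg (fun T : H →L[ℂ] H => T (L x)) hY.1
  refine Submodule.disjoint_def.1 hMS.disjoint _ (hLx ▸ hY.2 ⟨_, rfl⟩) ?_
  rw [hLx] at e1
  change S (L x) = 0
  rw [h.eq_sub]
  exact sub_eq_zero.2 e1

theorem tendsto_iterate_of_tendsto_pow (h : IsProperSplitting S U V) (hM : IsClosed (M : Set H))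
    (hMS : IsCompl M S.ker) {B : H →L[ℂ] H} (hB : B.range ≤ S.range)
    (hY : Tendsto (fun n : ℕ => reducedSolution M U V ^ n) atTop (𝓝 0)) (X₀ : H →L[ℂ] H) :
    Tendsto (iterate U V M B X₀) atTop (𝓝 (reducedSolution M S B)) := by
  rw [← tendsto_sub_nhds_zero_iff]
  simpa only [iterate_sub_reducedSolution h hM hMS hB, zero_mul] using
    hY.mul_const (X₀ - reducedSolution M S B)

theorem processConverges_iff_tendsto_pow (h : IsProperSplitting S U V)
    (hM : IsClosed (M : Set H)) (hMS : IsCompl M S.ker) {B : H →L[ℂ] H}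
    (hB : B.range ≤ S.range) :
    ProcessConverges U V M B ↔
      Tendsto (fun n : ℕ => reducedSolution M U V ^ n) atTop (𝓝 0) := by
  refine ⟨fun hc => ?_, fun hY X₀ => ⟨_, tendsto_iterate_of_tendsto_pow h hM hMS hB hY X₀⟩⟩
  -- With initial error `1` the errors are exactly the powers of `Y`.
  obtain ⟨X, hX⟩ := hc (1 + reducedSolution M S B)
  have hpow : Tendsto (fun n : ℕ => reducedSolution M U V ^ n) atTop
      (𝓝 (X - reducedSolution M S B)) := by
    simpa only [iterate_sub_reducedSolution h hM hMS hB, add_sub_cancel_right, mul_one] using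
      hX.sub_const (reducedSolution M S B)
  have hfix := tendsto_nhds_unique (hpow.const_mul (reducedSolution M U V))
    (by simpa only [pow_succ'] using (tendsto_add_atTop_iff_nat 1).2 hpow)
  rwa [h.eq_zero_of_reducedSolution_mul_eq hM hMS hfix] at hpow

/-- The reduced solution of `U Y = V` vanishes on `N(S)`: both `U` and `V = U - S` are zero there,
so `Y` maps `N(S)` into `M ⊓ N(U)`, which is trivial. -/
theorem IsProperSplitting.reducedSolution_mul_rangeProj_adjoint (h : IsProperSplitting S U V)
    (hM : IsClosed (M : Set H)) (hMS : IsCompl M S.ker) :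
    reducedSolution M U V * rangeProj S.adjoint = reducedSolution M U V := by
  have hY := h.isReducedSolution hM hMS
  ext x
  set z := x - rangeProj S.adjoint x with hz
  have hzS : z ∈ S.ker := sub_rangeProj_adjoint_mem_ker S x
  have hzU : U z = 0 := (h.ker_eq ▸ hzS : z ∈ U.ker)
  have hVz : V z = 0 := by
    have e : S z = U z - V z := congrArg (fun T : H →L[ℂ] H => T z) h.eq_sub
    have hzS' : S z = 0 := hzS
    simpa [hzU, hzS'] using e
  have hUY : U (reducedSolution M U V z) = 0 :=
    (congrArg (fun T : H →L[ℂ] H => T z) hY.1).trans hVz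
  have hYz : reducedSolution M U V z = 0 :=
    Submodule.disjoint_def.1 hMS.disjoint _ (hY.2 ⟨_, rfl⟩)
      (h.ker_eq ▸ (hUY : reducedSolution M U V z ∈ U.ker))
  rw [hz, map_sub, sub_eq_zero] at hYz
  exact hYz.symm

end Iteration

end ProperSplitting

/-! ### The convergence criterion -/

theorem mainTheorem4 {H : Type*} [NormedAddCommGroup H] [InnerProductSpace ℂ H] [CompleteSpace H]
    (S : H →L[ℂ] H) (hPL : ProperSplitting.IsProjMulHermitian S)
    (hS : IsClosed (S.range : Set H)) (hsplit : ProperSplitting.IsSplit S)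
    (U W Q : H →L[ℂ] H)
    (hU : U = ProperSplitting.rangeProj S ∘L ProperSplitting.rangeProj S.adjoint)
    (hW : W = U - S)
    (hQ : Q = ProperSplitting.obliqueProj S hsplit hS) :
    ProperSplitting.IsProperSplitting S U W ∧
    ∀ (M : Submodule ℂ H), IsClosed (M : Set H) → IsCompl M S.ker →
      ∀ B : H →L[ℂ] H, B.range ≤ S.range →
        (ProperSplitting.ProcessConverges U W M B ↔
          ‖ProperSplitting.rangeProj S.adjoint - Q.adjoint ∘L S‖ < 1) ∧
        (ProperSplitting.ProcessConverges U W M B →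
          ∀ X₀ : H →L[ℂ] H, Filter.Tendsto (ProperSplitting.iterate U W M B X₀) Filter.atTop
            (nhds (ProperSplitting.reducedSolution M S B))) := by
  subst hW hU
  have h := ProperSplitting.isProperSplitting_rangeProj_comp hsplit hS
  refine ⟨h, fun M hM hMS B hB => ?_⟩
  have hiff := ProperSplitting.processConverges_iff_tendsto_pow h hM hMS hB
  refine ⟨?_, fun hc X₀ =>
    ProperSplitting.tendsto_iterate_of_tendsto_pow h hM hMS hB (hiff.1 hc) X₀⟩
  have hself : IsSelfAdjoint (ProperSplitting.rangeProj S.adjoint - Q.adjoint ∘L S) := by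
    rw [hQ]
    exact (ProperSplitting.isSelfAdjoint_rangeProj _).sub
      (ProperSplitting.isSelfAdjoint_adjoint_comp hsplit hS hPL)
  rw [hiff, tendsto_pow_zero_iff_mul_left (h.reducedSolution_mul_rangeProj_adjoint hM hMS),
    ← hself.tendsto_pow_zero_iff]
  -- `P_{S*} Y = Q* U Y = Q* (U - S) = P_{S*} - Q* S`, independently of `M`
  have hQU := ProperSplitting.adjoint_obliqueProj_mul_rangeProj_mul_rangeProj hsplit hS
  rw [← hQ] at hQU
  have key : ProperSplitting.rangeProj S.adjoint * ProperSplitting.reducedSolution M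
      (ProperSplitting.rangeProj S ∘L ProperSplitting.rangeProj S.adjoint)
      (ProperSplitting.rangeProj S ∘L ProperSplitting.rangeProj S.adjoint - S) =
      ProperSplitting.rangeProj S.adjoint - Q.adjoint ∘L S := by
    refine (congrArg (· * _) hQU.symm).trans ((mul_assoc _ _ _).trans ?_)
    refine (congrArg (Q.adjoint * ·) (h.isReducedSolution hM hMS).1).trans ?_
    exact (mul_sub _ _ _).trans (congrArg (· - Q.adjoint ∘L S) hQU)
  rw [key]
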